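/- Let $m\ge 1$ and let $S, A_1, A_2\in\mathbb{R}^{m\times m}$ be symmetric matrices with $S$ nonsingular. Suppose that all complex eigenvalues of $S^{-1}A_1$ and of $S^{-1}A_2$ are real, and that $$[A_1,A_2]_S := S^{-1}A_1S^{-1}A_2 - S^{-1}A_2S^{-1}A_1 = 0.$$ Then the set $\{S,A_1,A_2\}$ is TWSD-B (bounded transformation-based weakly simultaneously diagonalizable): writing $B_1=S$, $B_2=A_1$, $B_3=A_2$, there exist real $m\times m$ matrices $P_k$ with $\det P_k=1$ and real diagonal $m\times m$ matrices $D_k^{(1)},D_k^{(2)},D_k^{(3)}$ ($k\ge 1$) such that $$\lim_{k\to\infty}\ \sum_{i=1}^{3}\bigl\|P_kB_iP_k^{\top}-D_k^{(i)}\bigr\|^2=0,$$ where $\|\cdot\|$ is the Frobenius norm, and the norms $\|D_k^{(i)}\|$ are bounded uniformly in $k$ and $i$. -/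

import Mathlib

open Filter Topology

namespace WeakSD

/-- The `S`-commutator `[A, B]_S = S⁻¹ A S⁻¹ B - S⁻¹ B S⁻¹ A` (used for nonsingular `S`). -/
noncomputable def sCommutator {m : ℕ} (S A B : Matrix (Fin m) (Fin m) ℝ) :
    Matrix (Fin m) (Fin m) ℝ :=
  S⁻¹ * A * S⁻¹ * B - S⁻¹ * B * S⁻¹ * A

/-- A real square matrix has only real eigenvalues: every complex eigenvalue is real. -/
def HasOnlyRealEigenvalues {m : ℕ} (M : Matrix (Fin m) (Fin m) ℝ) : Prop :=
  ∀ z : ℂ, Module.End.HasEigenvalue (Matrix.toLin' (M.map Complex.ofReal)) z → z.im = 0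

section Frobenius

attribute [local instance] Matrix.frobeniusNormedAddCommGroup

/-- The error measure `φ_T(P, D) = ∑ i, ‖P A_i Pᵀ - D_i‖²`, with the Frobenius norm. -/
noncomputable def phiT {m n L : ℕ} (A : Fin L → Matrix (Fin m) (Fin m) ℝ)
    (P : Matrix (Fin n) (Fin m) ℝ) (D : Fin L → Matrix (Fin n) (Fin n) ℝ) : ℝ :=
  ∑ i, ‖P * A i * P.transpose - D i‖ ^ 2

/-- Bounded transformation based weak simultaneous diagonalizability (TWSD-B) of a finite
family of matrices, with the Frobenius norm in the uniform bound. -/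
def IsTWSDB {m L : ℕ} (A : Fin L → Matrix (Fin m) (Fin m) ℝ) : Prop :=
  ∃ (P : ℕ → Matrix.SpecialLinearGroup (Fin m) ℝ)
    (D : ℕ → Fin L → Matrix (Fin m) (Fin m) ℝ),
    (∀ k i, (D k i).IsDiag) ∧
    Tendsto (fun k => phiT A (P k : Matrix (Fin m) (Fin m) ℝ) (D k)) atTop (𝓝 0) ∧
    ∃ M : ℝ, ∀ k i, ‖D k i‖ ≤ M

end Frobenius

end WeakSD

/-! View `S` as a nondegenerate symmetric form `B`. The operators `S⁻¹ * Aᵢ` are then commuting,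
self-adjoint, with real spectrum, so they share an eigenvector `v`; induct on dimension. If `B v v ≠
0`, split off the line of `v` orthogonally. If `B v v = 0`, pair `v` with an isotropic `w` and
compress to the complement of their span. The vectors `s⁻¹ • v ± s • w` have squares `±1`, and every
error they introduce carries a factor `s`, so it vanishes as `s → 0`. `S` is diagonalized exactly
with a fixed target, which fixes `|det P|`. One rescaling independent of the precision then gives
determinant one and keeps the targets bounded. -/

namespace WeakSD

open Module Polynomial

/-! ### Real spectrum and common eigenvectors. -/

section SplitEndomorphisms

variable {V : Type*} [AddCommGroup V] [Module ℝ V]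

/-- The endomorphism `f` is annihilated by a nonzero real polynomial with only real roots. -/
def HasSplitAnnihilator (f : End ℝ V) : Prop :=
  ∃ p : ℝ[X], p ≠ 0 ∧ p.Splits ∧ aeval f p = 0

theorem HasSplitAnnihilator.exists_eigenvector [FiniteDimensional ℝ V] [Nontrivial V] {f : End ℝ V}
    (hf : HasSplitAnnihilator f) : ∃ (a : ℝ) (v : V), v ≠ 0 ∧ f v = a • v := by
  obtain ⟨p, hp, hs, h0⟩ := hf
  have hm : (minpoly ℝ f).Splits := hs.of_dvd hp (minpoly.dvd ℝ f h0)
  obtain ⟨a, ha⟩ := hm.exists_eval_eq_zero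
    (minpoly.degree_pos (Algebra.IsIntegral.isIntegral f)).ne'
  obtain ⟨v, hv⟩ := (End.hasEigenvalue_of_isRoot ha).exists_hasEigenvector
  exact ⟨a, v, hv.2, hv.apply_eq_smul⟩

/-- An endomorphism intertwined, along an invariant subspace `W`, by a linear retraction with an
endomorphism `f` inherits a split annihilator from `f`. -/
theorem HasSplitAnnihilator.of_intertwine {f : End ℝ V} (hf : HasSplitAnnihilator f)
    {U : Submodule ℝ V} (W : Submodule ℝ V) (hUW : U ≤ W) (hW : ∀ x ∈ W, f x ∈ W)
    (π : V →ₗ[ℝ] U) (hπ : ∀ u : U, π u = u) (g : End ℝ U)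
    (hg : ∀ x ∈ W, g (π x) = π (f x)) : HasSplitAnnihilator g := by
  obtain ⟨p, hp, hs, h0⟩ := hf
  refine ⟨p, hp, hs, ?_⟩
  -- Orbits starting in `U` never leave `W`, the only place where `π` is known to intertwine `f` and
  -- `g`.
  have hpow : ∀ (k : ℕ) (u : U), (f ^ k) (u : V) ∈ W ∧ (g ^ k) u = π ((f ^ k) (u : V)) := by
    intro k u
    induction k with
    | zero => exact ⟨hUW u.2, by simp [hπ]⟩
    | succ k ih =>
      rw [pow_succ', pow_succ', Module.End.mul_apply, Module.End.mul_apply, ih.2]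
      exact ⟨hW _ ih.1, hg _ ih.1⟩
  have key : ∀ (q : ℝ[X]) (u : U), aeval g q u = π (aeval f q (u : V)) := by
    intro q u
    induction q using Polynomial.induction_on' with
    | add q r hq hr => simp [hq, hr]
    | monomial k c => simp [aeval_monomial, (hpow k u).2, Algebra.algebraMap_eq_smul_one]
  ext u
  simp [key, h0]

theorem exists_common_eigenvector [FiniteDimensional ℝ V] [Nontrivial V] {f g : End ℝ V}
    (hfg : ∀ x, f (g x) = g (f x))
    (hf : HasSplitAnnihilator f) (hg : HasSplitAnnihilator g) :
    ∃ (a b : ℝ) (v : V), v ≠ 0 ∧ f v = a • v ∧ g v = b • v := by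
  obtain ⟨a, v, hv, hfv⟩ := hf.exists_eigenvector
  let E := f.eigenspace a
  have hE : ∀ x ∈ E, g x ∈ E := by
    intro x hx
    rw [End.mem_eigenspace_iff] at hx ⊢
    rw [hfg, hx, map_smul]
  have : Nontrivial E := ⟨⟨⟨v, End.mem_eigenspace_iff.2 hfv⟩, 0, fun h => hv (by simpa using h)⟩⟩
  -- Any linear retraction works: `E` itself is invariant, so no invariant complement is needed.
  obtain ⟨π, hπ⟩ := E.subtype.exists_leftInverse_of_injective E.ker_subtype
  have hπ' : ∀ u : E, π u = u := fun u => LinearMap.congr_fun hπ u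
  have hr : HasSplitAnnihilator (g.restrict hE) := by
    refine hg.of_intertwine E le_rfl hE π hπ' _ fun x hx => ?_
    rw [hπ' ⟨x, hx⟩]
    exact (hπ' ⟨g x, hE x hx⟩).symm
  obtain ⟨b, w, hw, hgw⟩ := hr.exists_eigenvector
  refine ⟨a, b, w, by simpa using hw, End.mem_eigenspace_iff.1 w.2, ?_⟩
  simpa using congrArg Subtype.val hgw

end SplitEndomorphisms

/-- A nondegenerate symmetric form together with two commuting self-adjoint endomorphisms,
all of whose eigenvalues are real. -/
structure IsRealPair {V : Type*} [AddCommGroup V] [Module ℝ V]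
    (B : V →ₗ[ℝ] V →ₗ[ℝ] ℝ) (M : Fin 2 → End ℝ V) : Prop where
  symm : ∀ x y, B x y = B y x
  nondeg : ∀ x, (∀ y, B x y = 0) → x = 0
  adj : ∀ k x y, B (M k x) y = B x (M k y)
  comm : ∀ k l x, M k (M l x) = M l (M k x)
  split : ∀ k, HasSplitAnnihilator (M k)

/-! ### Compression of real pairs and the two inductive steps. -/

section Compression

variable {V : Type} [AddCommGroup V] [Module ℝ V]

/-- Compressing a real pair along an orthogonal projection `π` onto `U` gives a real pair, as soon
as `π` intertwines the endomorphisms on an invariant subspace `W` containing `U`. -/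
theorem IsRealPair.compress {B : V →ₗ[ℝ] V →ₗ[ℝ] ℝ} {M : Fin 2 → End ℝ V}
    (h : IsRealPair B M) {U : Submodule ℝ V} (W : Submodule ℝ V) (hUW : U ≤ W)
    (hW : ∀ k, ∀ x ∈ W, M k x ∈ W) (π : V →ₗ[ℝ] U) (hπ : ∀ u : U, π u = u)
    (hB : ∀ (u : U) x, B u (π x) = B u x)
    (hπM : ∀ k, ∀ x ∈ W, π (M k (π x)) = π (M k x)) :
    IsRealPair (B.domRestrict₁₂ U U) (fun k => π ∘ₗ M k ∘ₗ U.subtype) where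
  symm x y := h.symm _ _
  nondeg x hx := by
    refine Subtype.ext (h.nondeg x fun y => ?_)
    rw [← hB]
    exact hx (π y)
  adj k x y := by
    simp only [LinearMap.domRestrict₁₂_apply, LinearMap.comp_apply, Submodule.subtype_apply, hB]
    rw [h.symm, hB, h.symm, h.adj]
  comm k l x := by
    simp only [LinearMap.comp_apply, Submodule.subtype_apply]
    -- Both orders reduce to `π` applied to a product of the original operators, which commute.
    rw [hπM k _ (hW l _ (hUW x.2)), hπM l _ (hW k _ (hUW x.2)), h.comm]
  split k := (h.split k).of_intertwine W hUW (hW k) π hπ _ (hπM k)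

/-- The family `b` is exactly orthogonal for `B`, with squares `J`, and the forms
`B x (M k y)` are within `ε` of the diagonal forms `D k` on it. -/
def IsApproxDiag (B : V →ₗ[ℝ] V →ₗ[ℝ] ℝ) (M : Fin 2 → End ℝ V) {ι : Type} [DecidableEq ι]
    (J : ι → ℝ) (D : Fin 2 → ι → ℝ) (ε : ℝ) (b : ι → V) : Prop :=
  (∀ i j, B (b i) (b j) = Matrix.diagonal J i j) ∧
    ∀ k i j, |B (b i) (M k (b j)) - Matrix.diagonal (D k) i j| < ε

/-- Extending an approximately diagonalizing family by a non-isotropic eigenvector. -/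
theorem IsApproxDiag.option {B : V →ₗ[ℝ] V →ₗ[ℝ] ℝ} {M : Fin 2 → End ℝ V} {ι : Type}
    [DecidableEq ι] {J : ι → ℝ} {D : Fin 2 → ι → ℝ} {ε : ℝ} {b : ι → V}
    (h : IsApproxDiag B M J D ε b) (v : V) (c : ℝ) (a : Fin 2 → ℝ) (hv : B v v = c)
    (hv₁ : ∀ j, B v (b j) = 0) (hv₂ : ∀ j, B (b j) v = 0)
    (hM : ∀ k, |B v (M k v) - a k| < ε)
    (hM₁ : ∀ k j, |B v (M k (b j))| < ε) (hM₂ : ∀ k j, |B (b j) (M k v)| < ε) :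
    IsApproxDiag B M (fun i => Option.elim i c J) (fun k i => Option.elim i (a k) (D k)) ε
      (fun i => Option.elim i v b) := by
  refine ⟨?_, ?_⟩
  · rintro (_ | i) (_ | j)
    · simp [hv]
    · simp [hv₁]
    · simp [hv₂]
    · simpa [Matrix.diagonal_apply] using h.1 i j
  · rintro k (_ | i) (_ | j)
    · simpa using hM k
    · simpa using hM₁ k j
    · simpa using hM₂ k i
    · simpa [Matrix.diagonal_apply] using h.2 k i j

/-- Two functionals that are independent on a pair of vectors cut out codimension two. -/
theorem finrank_ker_prod_add_two [FiniteDimensional ℝ V] (f g : V →ₗ[ℝ] ℝ)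
    (v w : V) (hfv : f v = 0) (hfw : f w ≠ 0)
    (hgv : g v ≠ 0) : finrank ℝ (LinearMap.ker (f.prod g)) + 2 = finrank ℝ V := by
  have hsurj : Function.Surjective (f.prod g) := by
    rintro ⟨a, b⟩
    refine ⟨(a / f w) • w + ((b - a / f w * g w) / g v) • v, ?_⟩
    ext
    · simp [hfv, hfw]
    · simp; field_simp; ring
  have := LinearMap.finrank_range_add_finrank_ker (f.prod g)
  rw [LinearMap.range_eq_top.2 hsurj, finrank_top, finrank_prod] at this
  simp at this
  omega

theorem finrank_ker_add_one [FiniteDimensional ℝ V] (f : V →ₗ[ℝ] ℝ) (v : V) (hfv : f v ≠ 0) :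
    finrank ℝ (LinearMap.ker f) + 1 = finrank ℝ V := by
  have hsurj : Function.Surjective f := fun a =>
    ⟨(a / f v) • v, by rw [map_smul, smul_eq_mul]; field_simp⟩
  have := LinearMap.finrank_range_add_finrank_ker f
  rw [LinearMap.range_eq_top.2 hsurj, finrank_top, finrank_self] at this
  omega

/-- The conclusion of the diagonalization theorem: for fixed `J`, `D`, approximately diagonalizing
families of full cardinality exist at every precision. -/
def IsApproxDiagonalizable (B : V →ₗ[ℝ] V →ₗ[ℝ] ℝ) (M : Fin 2 → End ℝ V) : Prop :=
  ∃ (ι : Type) (_ : Fintype ι) (_ : DecidableEq ι) (J : ι → ℝ) (D : Fin 2 → ι → ℝ),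
    Fintype.card ι = finrank ℝ V ∧ (∀ i, J i ≠ 0) ∧ ∀ ε > 0, ∃ b, IsApproxDiag B M J D ε b

theorem IsRealPair.step_nonisotropic [FiniteDimensional ℝ V] {B : V →ₗ[ℝ] V →ₗ[ℝ] ℝ}
    {M : Fin 2 → End ℝ V}
    (h : IsRealPair B M) {v : V} {a : Fin 2 → ℝ} (hM : ∀ k, M k v = a k • v) (hv : B v v ≠ 0)
    (ih : ∀ (U : Submodule ℝ V) (B' : U →ₗ[ℝ] U →ₗ[ℝ] ℝ) (M' : Fin 2 → End ℝ U),
      finrank ℝ U < finrank ℝ V → IsRealPair B' M' → IsApproxDiagonalizable B' M') :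
    IsApproxDiagonalizable B M := by
  let U := LinearMap.ker (B v)
  have hU : finrank ℝ U + 1 = finrank ℝ V := finrank_ker_add_one (B v) v hv
  have memU : ∀ u : U, B v u = 0 := fun u => u.2
  have hinv : ∀ k, ∀ x ∈ U, M k x ∈ U := by
    intro k x hx
    rw [LinearMap.mem_ker] at hx ⊢
    rw [← h.adj, hM, map_smul, LinearMap.smul_apply, hx, smul_zero]
  let π₀ : V →ₗ[ℝ] V := LinearMap.id - ((B v v)⁻¹ • B v).smulRight v
  have hπ₀ : ∀ x, π₀ x = x - ((B v v)⁻¹ * B v x) • v := fun x => rfl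
  let π : V →ₗ[ℝ] U := π₀.codRestrict U fun x => by
    rw [LinearMap.mem_ker, hπ₀, map_sub, map_smul, smul_eq_mul]
    field_simp
    ring
  have hπ : ∀ x, (π x : V) = x - ((B v v)⁻¹ * B v x) • v := fun x => rfl
  have hπU : ∀ u : U, π u = u := fun u => Subtype.ext (by rw [hπ, memU]; simp)
  obtain ⟨ι, _, _, J, D, hcard, hJ, hb⟩ := ih U _ _ (by omega) <|
    h.compress U le_rfl hinv π hπU
      (fun u x => by rw [hπ, map_sub, map_smul, h.symm u v, memU]; simp)
      (fun k x hx => by rw [hπU ⟨x, hx⟩])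
  refine ⟨Option ι, inferInstance, inferInstance, fun i => Option.elim i (B v v) J,
    fun k i => Option.elim i (a k * B v v) (D k), ?_, ?_, ?_⟩
  · rw [Fintype.card_option, hcard, hU]
  · rintro (_ | i)
    · exact hv
    · exact hJ i
  intro ε hε
  obtain ⟨b, hb⟩ := hb ε hε
  have hb' : IsApproxDiag B M J D ε (fun i => (b i : V)) := by
    refine ⟨hb.1, fun k i j => ?_⟩
    have := hb.2 k i j
    simp only [LinearMap.domRestrict₁₂_apply, LinearMap.comp_apply, Submodule.subtype_apply] at this
    rwa [hπU ⟨_, hinv k _ (b j).2⟩] at this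
  refine ⟨_, hb'.option v (B v v) (fun k => a k * B v v) rfl (fun j => memU _)
    (fun j => by rw [h.symm, memU]) (fun k => ?_) (fun k j => ?_) (fun k j => ?_)⟩
  · rw [hM, map_smul, smul_eq_mul, sub_self, abs_zero]; exact hε
  · rw [← h.adj, hM, map_smul, LinearMap.smul_apply, memU, smul_zero, abs_zero]; exact hε
  · rw [hM, map_smul, h.symm, memU, smul_zero, abs_zero]; exact hε

theorem IsRealPair.exists_hyperbolic_partner {B : V →ₗ[ℝ] V →ₗ[ℝ] ℝ} {M : Fin 2 → End ℝ V}
    (h : IsRealPair B M) {v : V} (hv₀ : v ≠ 0) (hv : B v v = 0) :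
    ∃ w, B v w = 1 / 2 ∧ B w v = 1 / 2 ∧ B w w = 0 := by
  obtain ⟨y, hy⟩ : ∃ y, B v y ≠ 0 := by
    by_contra! hcon
    exact hv₀ (h.nondeg v hcon)
  let z := (1 / (2 * B v y)) • y
  have hz : B v z = 1 / 2 := by
    simp only [z, map_smul, smul_eq_mul]
    field_simp
  have hz' : B z v = 1 / 2 := by rw [h.symm, hz]
  -- As `B z v = 1/2`, subtracting `B z z • v` lowers the square by exactly `B z z`.
  refine ⟨z - B z z • v, ?_, ?_, ?_⟩ <;>
    simp only [map_sub, map_smul, LinearMap.sub_apply, LinearMap.smul_apply, smul_eq_mul, hz, hz',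
      hv] <;> ring

theorem IsRealPair.step_isotropic [FiniteDimensional ℝ V] {B : V →ₗ[ℝ] V →ₗ[ℝ] ℝ}
    {M : Fin 2 → End ℝ V}
    (h : IsRealPair B M) {v : V} {a : Fin 2 → ℝ} (hM : ∀ k, M k v = a k • v) (hv₀ : v ≠ 0)
    (hv : B v v = 0)
    (ih : ∀ (U : Submodule ℝ V) (B' : U →ₗ[ℝ] U →ₗ[ℝ] ℝ) (M' : Fin 2 → End ℝ U),
      finrank ℝ U < finrank ℝ V → IsRealPair B' M' → IsApproxDiagonalizable B' M') :
    IsApproxDiagonalizable B M := by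
  obtain ⟨w, hvw, hwv, hw⟩ := h.exists_hyperbolic_partner hv₀ hv
  let U := LinearMap.ker ((B v).prod (B w))
  have hU : finrank ℝ U + 2 = finrank ℝ V :=
    finrank_ker_prod_add_two (B v) (B w) v w hv (by rw [hvw]; norm_num) (by rw [hwv]; norm_num)
  have memU : ∀ u : U, B v u = 0 ∧ B w u = 0 := fun u => by simpa [U] using u.2
  have memU' : ∀ u : U, B u v = 0 ∧ B u w = 0 := fun u => by
    rw [h.symm u v, h.symm u w]; exact memU u
  -- `U` need not be invariant, but `W`, the complement of the eigenvector `v`, is. On `W` the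
  -- projection only removes a multiple of `v`, which `M k` preserves and `π` kills.
  let W := LinearMap.ker (B v)
  have hUW : U ≤ W := fun u hu => (memU ⟨u, hu⟩).1
  have hinv : ∀ k, ∀ x ∈ W, M k x ∈ W := by
    intro k x hx
    rw [LinearMap.mem_ker] at hx ⊢
    rw [← h.adj, hM, map_smul, LinearMap.smul_apply, hx, smul_zero]
  let π₀ : V →ₗ[ℝ] V := LinearMap.id - ((2 : ℝ) • B w).smulRight v - ((2 : ℝ) • B v).smulRight w
  have hπ₀ : ∀ x, π₀ x = x - (2 * B w x) • v - (2 * B v x) • w := fun x => rfl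
  let π : V →ₗ[ℝ] U := π₀.codRestrict U fun x => by
    rw [LinearMap.mem_ker, hπ₀]
    ext
    · simp [hv, hvw]; ring
    · simp [hw, hwv]; ring
  have hπ : ∀ x, (π x : V) = x - (2 * B w x) • v - (2 * B v x) • w := fun x => rfl
  have hπU : ∀ u : U, π u = u := fun u => Subtype.ext (by rw [hπ, (memU u).1, (memU u).2]; simp)
  have hπv : π v = 0 := Subtype.ext (by rw [hπ, hv, hwv]; simp)
  have hBπ : ∀ (u : U) x, B u (π x) = B u x := fun u x => by
    rw [hπ]; simp [(memU' u).1, (memU' u).2]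
  obtain ⟨ι, _, _, J, D, hcard, hJ, hb⟩ := ih U _ _ (by omega) <|
    h.compress W hUW hinv π hπU hBπ (fun k x hx => by
      rw [hπ, (LinearMap.mem_ker.1 hx : B v x = 0)]
      simp [hM, hπv])
  refine ⟨Option (Option ι), inferInstance, inferInstance,
    fun i => Option.elim i 1 fun i => Option.elim i (-1) J,
    fun k i => Option.elim i (a k) fun i => Option.elim i (-a k) (D k), ?_, ?_, ?_⟩
  · rw [Fintype.card_option, Fintype.card_option, hcard, ← hU]
  · rintro (_ | _ | i)
    · exact one_ne_zero
    · exact neg_ne_zero.2 one_ne_zero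
    · exact hJ i
  intro ε hε
  obtain ⟨b, hb⟩ := hb ε hε
  have hb' : IsApproxDiag B M J D ε (fun i => (b i : V)) := by
    refine ⟨hb.1, fun k i j => ?_⟩
    have := hb.2 k i j
    simp only [LinearMap.domRestrict₁₂_apply, LinearMap.comp_apply, Submodule.subtype_apply] at this
    rwa [hBπ] at this
  -- `s` is chosen after `b`, hence depends on `ε`; the targets `±1` and `±a k` do not.
  obtain ⟨s, hs, hs₁, hs₂⟩ : ∃ s : ℝ, s ≠ 0 ∧ (∀ k, |s * (s * B w (M k w))| < ε) ∧
      ∀ k j, |s * B w (M k (b j))| < ε := by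
    have hlim : ∀ c : ℝ, ∀ᶠ s in 𝓝[≠] (0 : ℝ), |s * c| < ε := fun c => by
      have : Tendsto (fun s : ℝ => |s * c|) (𝓝[≠] 0) (𝓝 0) := by
        have : ContinuousAt (fun s : ℝ => |s * c|) 0 := by fun_prop
        simpa using this.tendsto.mono_left nhdsWithin_le_nhds
      exact this.eventually_lt_const hε
    have hlim' : ∀ c : ℝ, ∀ᶠ s in 𝓝[≠] (0 : ℝ), |s * (s * c)| < ε := fun c => by
      have : Tendsto (fun s : ℝ => |s * (s * c)|) (𝓝[≠] 0) (𝓝 0) := by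
        have : ContinuousAt (fun s : ℝ => |s * (s * c)|) 0 := by fun_prop
        simpa using this.tendsto.mono_left nhdsWithin_le_nhds
      exact this.eventually_lt_const hε
    have h₁ := Filter.eventually_all.2 fun k => hlim' (B w (M k w))
    have h₂ := Filter.eventually_all.2 fun k => Filter.eventually_all.2 fun j =>
      hlim (B w (M k (b j)))
    obtain ⟨s, hs, h⟩ := (eventually_mem_nhdsWithin.and (h₁.and h₂)).exists
    exact ⟨s, hs, h⟩
  -- This vanishing makes the large coefficient `s⁻¹` harmless: `v` contributes nothing against `M k
  -- (b j)`.
  have hvM : ∀ k j, B v (M k (b j)) = 0 := fun k j => by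
    rw [← h.adj, hM, map_smul, LinearMap.smul_apply, (memU _).1, smul_zero]
  have hMw : ∀ k, B v (M k w) = a k / 2 := fun k => by
    rw [← h.adj, hM, map_smul, LinearMap.smul_apply, hvw, smul_eq_mul]; ring
  have hbMw : ∀ k j, B (b j) (M k w) = B w (M k (b j)) := fun k j => by rw [← h.adj, h.symm]
  have habs : ∀ x : ℝ, |x| < ε → |-x| < ε := fun x hx => by rwa [abs_neg]
  have hinner := hb'.option (s⁻¹ • v - s • w) (-1) (fun k => -a k)
    (by simp [hv, hvw, hwv, hw]; field_simp; ring)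
    (fun j => by simp [(memU (b j)).1, (memU (b j)).2])
    (fun j => by simp [(memU' (b j)).1, (memU' (b j)).2])
    (fun k => by
      convert hs₁ k using 2
      simp [hM, hv, hwv, hMw]; field_simp; ring)
    (fun k j => by
      convert habs _ (hs₂ k j) using 2
      simp [hvM])
    (fun k j => by
      convert habs _ (hs₂ k j) using 2
      simp [hM, (memU' (b j)).1, hbMw])
  refine ⟨_, hinner.option (s⁻¹ • v + s • w) 1 a
    (by simp [hv, hvw, hwv, hw]; field_simp; ring) ?_ ?_ ?_ ?_ ?_⟩
  · rintro (_ | j)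
    · simp [hv, hvw, hwv, hw]; field_simp; ring
    · simp [(memU (b j)).1, (memU (b j)).2]
  · rintro (_ | j)
    · simp [hv, hvw, hwv, hw]; field_simp; ring
    · simp [(memU' (b j)).1, (memU' (b j)).2]
  · intro k
    convert hs₁ k using 2
    simp [hM, hv, hwv, hMw]; field_simp; ring
  · rintro k (_ | j)
    · convert habs _ (hs₁ k) using 2
      simp [hM, hv, hwv, hMw]; field_simp; ring
    · convert hs₂ k j using 2
      simp [hvM]
  · rintro k (_ | j)
    · convert habs _ (hs₁ k) using 2
      simp [hM, hv, hwv, hMw]; field_simp; ring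
    · convert hs₂ k j using 2
      simp [hM, (memU' (b j)).1, hbMw]

end Compression

theorem IsRealPair.isApproxDiagonalizable (n : ℕ) :
    ∀ (V : Type) [AddCommGroup V] [Module ℝ V] [FiniteDimensional ℝ V]
      (B : V →ₗ[ℝ] V →ₗ[ℝ] ℝ) (M : Fin 2 → End ℝ V), finrank ℝ V = n → IsRealPair B M →
      IsApproxDiagonalizable B M := by
  induction n using Nat.strong_induction_on with
  | _ n ih =>
    intro V _ _ _ B M hn h
    rcases Nat.eq_zero_or_pos n with rfl | hpos
    · exact ⟨Empty, inferInstance, inferInstance, Empty.elim, fun _ => Empty.elim, by simp [hn],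
        fun i => i.elim, fun ε _ => ⟨Empty.elim, fun i => i.elim, fun _ i => i.elim⟩⟩
    have : Nontrivial V := finrank_pos_iff.1 (hn ▸ hpos)
    obtain ⟨a₀, a₁, v, hv, h₀, h₁⟩ := exists_common_eigenvector (h.comm 0 1) (h.split 0) (h.split 1)
    have hM : ∀ k, M k v = (![a₀, a₁] k) • v := by
      intro k
      fin_cases k
      · simpa using h₀
      · simpa using h₁
    have ih' : ∀ (U : Submodule ℝ V) (B' : U →ₗ[ℝ] U →ₗ[ℝ] ℝ) (M' : Fin 2 → End ℝ U),
        finrank ℝ U < finrank ℝ V → IsRealPair B' M' → IsApproxDiagonalizable B' M' :=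
      fun U B' M' hU => ih _ (hn ▸ hU) U B' M' rfl
    by_cases hB : B v v = 0
    · exact h.step_isotropic hM hv hB ih'
    · exact h.step_nonisotropic hM hB ih'

/-! ### Translation to matrices and normalization of the determinant. -/

section Matrices

open Matrix

variable {m : ℕ}

/-- The characteristic polynomial serves: its complex roots are eigenvalues, hence real, and
Cayley–Hamilton applies. -/
theorem HasOnlyRealEigenvalues.hasSplitAnnihilator {M : Matrix (Fin m) (Fin m) ℝ}
    (hM : HasOnlyRealEigenvalues M) : HasSplitAnnihilator (Matrix.toLin' M) := by
  refine ⟨M.charpoly, M.charpoly_monic.ne_zero, ?_, ?_⟩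
  · refine Polynomial.Splits.of_splits_map Complex.ofRealHom (IsAlgClosed.splits _) fun z hz => ?_
    have hroot : (Matrix.toLin' (M.map Complex.ofReal)).charpoly.IsRoot z := by
      rw [← Matrix.charpoly_map] at hz
      have := Polynomial.isRoot_of_mem_roots hz
      rwa [Matrix.charpoly_toLin']
    have him := hM z (End.hasEigenvalue_iff_isRoot_charpoly _ _ |>.2 hroot)
    exact ⟨z.re, Complex.ext rfl (by simpa using him.symm)⟩
  · have := LinearMap.aeval_self_charpoly (Matrix.toLin' M)
    rwa [Matrix.charpoly_toLin'] at this

theorem isRealPair_of_matrix {S A₁ A₂ : Matrix (Fin m) (Fin m) ℝ}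
    (hS : S.IsSymm) (hA₁ : A₁.IsSymm) (hA₂ : A₂.IsSymm) (hdet : S.det ≠ 0)
    (hreal₁ : HasOnlyRealEigenvalues (S⁻¹ * A₁)) (hreal₂ : HasOnlyRealEigenvalues (S⁻¹ * A₂))
    (hcomm : sCommutator S A₁ A₂ = 0) :
    IsRealPair (Matrix.toLinearMap₂' ℝ S)
      (fun k => Matrix.toLin' (S⁻¹ * (![A₁, A₂] : Fin 2 → Matrix (Fin m) (Fin m) ℝ) k)) := by
  have hunit : IsUnit S.det := hdet.isUnit
  have hA : ∀ k, ((![A₁, A₂] : Fin 2 → Matrix (Fin m) (Fin m) ℝ) k).IsSymm := by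
    intro k; fin_cases k
    · exact hA₁
    · exact hA₂
  have hsymm : ∀ (A : Matrix (Fin m) (Fin m) ℝ), A.IsSymm → ∀ x y : Fin m → ℝ,
      x ⬝ᵥ A *ᵥ y = y ⬝ᵥ A *ᵥ x := fun A hA x y => by
    rw [Matrix.dotProduct_mulVec, dotProduct_comm, ← Matrix.mulVec_transpose, hA.eq]
  refine ⟨fun x y => ?_, fun x hx => ?_, fun k x y => ?_, ?_, ?_⟩
  · simpa only [Matrix.toLinearMap₂'_apply'] using hsymm S hS x y
  · have h0 : ∀ y, y ⬝ᵥ S *ᵥ x = 0 := fun y => by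
      rw [hsymm S hS]
      simpa only [Matrix.toLinearMap₂'_apply'] using hx y
    have h1 : S *ᵥ x = 0 := dotProduct_self_eq_zero.1 (h0 _)
    exact Matrix.eq_zero_of_mulVec_eq_zero hdet h1
  · simp only [Matrix.toLinearMap₂'_apply', Matrix.toLin'_apply]
    rw [hsymm S hS, Matrix.mulVec_mulVec, Matrix.mulVec_mulVec,
      Matrix.mul_nonsing_inv_cancel_left _ _ hunit, hsymm _ (hA k)]
  · have hc : S⁻¹ * (A₁ * (S⁻¹ * A₂)) = S⁻¹ * (A₂ * (S⁻¹ * A₁)) := by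
      simpa only [Matrix.mul_assoc] using sub_eq_zero.1 hcomm
    intro k l x
    fin_cases k <;> fin_cases l <;> simp [hc]
  · intro k
    fin_cases k
    · exact hreal₁.hasSplitAnnihilator
    · exact hreal₂.hasSplitAnnihilator

theorem toLinearMap₂'_apply_toLin'_inv_mul {S : Matrix (Fin m) (Fin m) ℝ} (hdet : S.det ≠ 0)
    (A : Matrix (Fin m) (Fin m) ℝ) (x y : Fin m → ℝ) :
    Matrix.toLinearMap₂' ℝ S x (Matrix.toLin' (S⁻¹ * A) y) = x ⬝ᵥ A *ᵥ y := by
  rw [Matrix.toLinearMap₂'_apply', Matrix.toLin'_apply, Matrix.mulVec_mulVec,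
    Matrix.mul_nonsing_inv_cancel_left _ _ hdet.isUnit]

theorem mul_mul_transpose_apply (P A : Matrix (Fin m) (Fin m) ℝ) (i j : Fin m) :
    (P * A * Pᵀ) i j = P i ⬝ᵥ A *ᵥ P j := by
  rw [Matrix.mul_assoc, Matrix.mul_apply]
  simp [dotProduct, Matrix.mulVec, Matrix.mul_apply]

/-- Matrix form of the approximate diagonalization: `S` is diagonalized exactly, `A₁` and `A₂` up
to an arbitrarily small entrywise error, with diagonal targets independent of the error. -/
theorem exists_matrix_approx_diag {S A₁ A₂ : Matrix (Fin m) (Fin m) ℝ}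
    (hdet : S.det ≠ 0)
    (h : IsRealPair (Matrix.toLinearMap₂' ℝ S)
      (fun k => Matrix.toLin' (S⁻¹ * (![A₁, A₂] : Fin 2 → Matrix (Fin m) (Fin m) ℝ) k))) :
    ∃ (D : Fin 3 → Fin m → ℝ) (q : ℝ), 0 < q ∧ ∀ ε > 0, ∃ P : Matrix (Fin m) (Fin m) ℝ,
      |P.det| = q ∧ ∀ k i j, |(P * (![S, A₁, A₂] : Fin 3 → Matrix (Fin m) (Fin m) ℝ) k * Pᵀ) i j
        - Matrix.diagonal (D k) i j| < ε := by
  obtain ⟨ι, _, _, J, D, hcard, hJ, hb⟩ := IsRealPair.isApproxDiagonalizable _ _ _ _ rfl h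
  rw [finrank_fin_fun] at hcard
  let e : Fin m ≃ ι := (Fintype.equivFinOfCardEq hcard).symm
  have hJdet : (∏ i, J (e i)) ≠ 0 := Finset.prod_ne_zero_iff.2 fun i _ => hJ _
  have hpos : 0 < |(∏ i, J (e i)) / S.det| := abs_pos.2 (div_ne_zero hJdet hdet)
  -- Taking determinants in `P * S * Pᵀ = diagonal (J ∘ e)` forces this value of `|det P|`.
  refine ⟨![J ∘ e, D 0 ∘ e, D 1 ∘ e], √|(∏ i, J (e i)) / S.det|, Real.sqrt_pos.2 hpos, ?_⟩
  intro ε hε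
  obtain ⟨b, hb₁, hb₂⟩ := hb ε hε
  let P : Matrix (Fin m) (Fin m) ℝ := fun i => b (e i)
  have hdiag : ∀ (d : ι → ℝ) (i j : Fin m),
      Matrix.diagonal (d ∘ e) i j = Matrix.diagonal d (e i) (e j) := fun d i j => by
    simp [Matrix.diagonal_apply]
  have hPS : P * S * Pᵀ = Matrix.diagonal (J ∘ e) := by
    ext i j
    rw [mul_mul_transpose_apply, hdiag, ← hb₁, Matrix.toLinearMap₂'_apply']
  refine ⟨P, ?_, fun k i j => ?_⟩
  · have hd := congrArg Matrix.det hPS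
    rw [Matrix.det_mul, Matrix.det_mul, Matrix.det_transpose, Matrix.det_diagonal] at hd
    have : P.det ^ 2 = (∏ i, J (e i)) / S.det := by
      rw [eq_div_iff hdet]
      simp only [Function.comp] at hd
      rw [← hd]; ring
    rw [← this, abs_of_nonneg (sq_nonneg P.det), Real.sqrt_sq_eq_abs]
  · have h0 := hb₂ 0 (e i) (e j)
    have h1 := hb₂ 1 (e i) (e j)
    rw [toLinearMap₂'_apply_toLin'_inv_mul hdet, ← hdiag] at h0 h1
    have hPb : ∀ i, b (e i) = P i := fun _ => rfl
    rw [hPb, hPb] at h0 h1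
    fin_cases k
    · simpa [hPS] using hε
    · simpa [mul_mul_transpose_apply P] using h0
    · simpa [mul_mul_transpose_apply P] using h1

/-- Negating one row, if necessary, makes the determinant positive without spoiling the
approximate diagonality. -/
theorem exists_det_pos_of_abs_det {L : ℕ} (hm : 0 < m) (A : Fin L → Matrix (Fin m) (Fin m) ℝ)
    (D : Fin L → Fin m → ℝ) {q ε : ℝ} (P : Matrix (Fin m) (Fin m) ℝ) (hP : |P.det| = q)
    (h : ∀ k i j, |(P * A k * Pᵀ) i j - Matrix.diagonal (D k) i j| < ε) :
    ∃ Q : Matrix (Fin m) (Fin m) ℝ, Q.det = q ∧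
      ∀ k i j, |(Q * A k * Qᵀ) i j - Matrix.diagonal (D k) i j| < ε := by
  rcases abs_choice P.det with hc | hc
  · exact ⟨P, by rw [← hP, hc], h⟩
  -- A sign change multiplies entry `(i, j)` by `d i * d j`, which is `1` on the diagonal.
  let d : Fin m → ℝ := fun i => if i = ⟨0, hm⟩ then -1 else 1
  have hd : ∀ i, d i * d i = 1 := fun i => by simp only [d]; split_ifs <;> norm_num
  have habs : ∀ i, |d i| = 1 := fun i => by simp only [d]; split_ifs <;> norm_num
  refine ⟨Matrix.diagonal d * P, ?_, fun k i j => ?_⟩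
  · rw [Matrix.det_mul, Matrix.det_diagonal, ← hP, hc]
    simp [d, Finset.prod_ite_eq']
  · have heq : (Matrix.diagonal d * P * A k * (Matrix.diagonal d * P)ᵀ) i j
        - Matrix.diagonal (D k) i j
        = d i * d j * ((P * A k * Pᵀ) i j - Matrix.diagonal (D k) i j) := by
      have : Matrix.diagonal d * P * A k * (Matrix.diagonal d * P)ᵀ
          = Matrix.diagonal d * (P * A k * Pᵀ) * Matrix.diagonal d := by
        simp only [Matrix.transpose_mul, Matrix.diagonal_transpose, Matrix.mul_assoc]
      rw [this, Matrix.mul_diagonal, Matrix.diagonal_mul]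
      by_cases hij : i = j
      · subst hij
        rw [hd, mul_right_comm, hd]; ring
      · rw [Matrix.diagonal_apply_ne _ hij]; ring
    rw [heq, abs_mul, abs_mul, habs, habs, one_mul, one_mul]
    exact h k i j

/-- Rescaling normalizes the determinant to one, at the price of rescaling the targets. -/
theorem exists_det_one_of_approx_diag {L : ℕ} (hm : 0 < m)
    (A : Fin L → Matrix (Fin m) (Fin m) ℝ) (D : Fin L → Fin m → ℝ) {q : ℝ} (hq : 0 < q)
    (h : ∀ ε > 0, ∃ P : Matrix (Fin m) (Fin m) ℝ, |P.det| = q ∧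
      ∀ k i j, |(P * A k * Pᵀ) i j - Matrix.diagonal (D k) i j| < ε) :
    ∃ E : Fin L → Fin m → ℝ, ∀ ε > 0, ∃ P : SpecialLinearGroup (Fin m) ℝ,
      ∀ k i j, |((P : Matrix (Fin m) (Fin m) ℝ) * A k * (P : Matrix (Fin m) (Fin m) ℝ)ᵀ) i j
        - Matrix.diagonal (E k) i j| < ε := by
  let c : ℝ := (q⁻¹) ^ ((m : ℝ)⁻¹)
  have hc : 0 < c := Real.rpow_pos_of_pos (inv_pos.2 hq) _
  have hcm : c ^ m = q⁻¹ := Real.rpow_inv_natCast_pow (inv_pos.2 hq).le hm.ne'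
  refine ⟨fun k => (c * c) • D k, fun ε hε => ?_⟩
  obtain ⟨P, hP, hPA⟩ := h (ε / (c * c)) (by positivity)
  obtain ⟨Q, hQ, hQA⟩ := exists_det_pos_of_abs_det hm A D P hP hPA
  refine ⟨⟨c • Q, ?_⟩, fun k i j => ?_⟩
  · rw [Matrix.det_smul, hQ, Fintype.card_fin, hcm, inv_mul_cancel₀ hq.ne']
  · have heq : ((c • Q) * A k * (c • Q)ᵀ) i j - Matrix.diagonal ((c * c) • D k) i j
        = (c * c) * ((Q * A k * Qᵀ) i j - Matrix.diagonal (D k) i j) := by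
      rw [Matrix.diagonal_smul]
      simp [Matrix.transpose_smul, mul_sub, mul_assoc]
    change |((c • Q) * A k * (c • Q)ᵀ) i j - Matrix.diagonal ((c * c) • D k) i j| < ε
    rw [heq, abs_mul, abs_of_pos (by positivity)]
    have := hQA k i j
    rwa [lt_div_iff₀' (by positivity)] at this

/-! ### From entrywise bounds to the Frobenius limit. -/

section Frobenius

attribute [local instance] Matrix.frobeniusNormedAddCommGroup

theorem isTWSDB_of_approx_diag {L : ℕ} {A : Fin L → Matrix (Fin m) (Fin m) ℝ}
    {E : Fin L → Fin m → ℝ}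
    (h : ∀ ε > 0, ∃ P : SpecialLinearGroup (Fin m) ℝ,
      ∀ k i j, |((P : Matrix (Fin m) (Fin m) ℝ) * A k * (P : Matrix (Fin m) (Fin m) ℝ)ᵀ) i j
        - Matrix.diagonal (E k) i j| < ε) : IsTWSDB A := by
  choose P hP using fun n : ℕ => h (1 / (n + 1)) Nat.one_div_pos_of_nat
  refine ⟨P, fun _ i => Matrix.diagonal (E i), fun _ i => Matrix.isDiag_diagonal _, ?_,
    ∑ i, ‖Matrix.diagonal (E i)‖, fun _ i =>
      Finset.single_le_sum (f := fun i => ‖Matrix.diagonal (E i)‖) (fun _ _ => norm_nonneg _)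
        (Finset.mem_univ i)⟩
  have hlim : ∀ k, Tendsto (fun n => ‖(P n : Matrix (Fin m) (Fin m) ℝ) * A k *
      (P n : Matrix (Fin m) (Fin m) ℝ)ᵀ - Matrix.diagonal (E k)‖) atTop (𝓝 0) := by
    intro k
    -- The Frobenius norm induces the product topology, so entrywise convergence suffices.
    refine tendsto_zero_iff_norm_tendsto_zero.1 ?_
    refine tendsto_pi_nhds.2 fun i => tendsto_pi_nhds.2 fun j => ?_
    exact squeeze_zero_norm (fun n => (hP n k i j).le) tendsto_one_div_add_atTop_nhds_zero_nat
  simpa [phiT] using tendsto_finsetSum Finset.univ fun k _ => (hlim k).pow 2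

end Frobenius

end Matrices

end WeakSD

theorem mainTheorem8 (m : ℕ) (S A₁ A₂ : Matrix (Fin m) (Fin m) ℝ)
    (hS : S.IsSymm) (hA₁ : A₁.IsSymm) (hA₂ : A₂.IsSymm)
    (hdet : S.det ≠ 0)
    (hreal₁ : WeakSD.HasOnlyRealEigenvalues (S⁻¹ * A₁))
    (hreal₂ : WeakSD.HasOnlyRealEigenvalues (S⁻¹ * A₂))
    (hcomm : WeakSD.sCommutator S A₁ A₂ = 0) :
    WeakSD.IsTWSDB ![S, A₁, A₂] := by
  -- Normalizing the determinant takes an `m`-th root and flips a row, so `m = 0` is separate.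
  rcases Nat.eq_zero_or_pos m with rfl | hm
  · exact WeakSD.isTWSDB_of_approx_diag (E := fun _ => Fin.elim0) fun _ _ =>
      ⟨1, fun _ i => i.elim0⟩
  obtain ⟨D, q, hq, h⟩ := WeakSD.exists_matrix_approx_diag hdet
    (WeakSD.isRealPair_of_matrix hS hA₁ hA₂ hdet hreal₁ hreal₂ hcomm)
  obtain ⟨E, hE⟩ := WeakSD.exists_det_one_of_approx_diag hm _ D hq h
  exact WeakSD.isTWSDB_of_approx_diag hE
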